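/- Let $m,n\in\mathbb N$, let $A\in\mathbb R^{m\times n}$ have columns $A_1,\dots,A_n$, and for $(b,\lambda)\in\mathbb R^m\times\mathbb R$ let $$S(b,\lambda)=\operatorname*{argmin}_{x\in\mathbb R^n}\ \big\{\|Ax-b\|+\lambda\|x\|_1\big\}$$ be the (possibly multi-valued) solution set of the SR-LASSO, where $\|\cdot\|$ is the Euclidean norm. Let $(\bar b,\bar\lambda)\in\mathbb R^m\times(0,\infty)$ and suppose that $\{Ax:x\in S(\bar b,\bar\lambda)\}\neq\{\bar b\}$. Then the following are equivalent: (a) The set-valued mapping $S$ is locally (Hausdorff) Lipschitz at $(\bar b,\bar\lambda)$: there exist $\delta,L\in(0,\infty)$ such that $$d_H\big(S(b,\lambda),S(b',\lambda')\big)\le L\,\|(b,\lambda)-(b',\lambda')\|$$ for all $(b,\lambda),(b',\lambda')$ in the open Euclidean ball of radius $\delta$ around $(\bar b,\bar\lambda)$ in $\mathbb R^m\times\mathbb R$, where $d_H$ is the ($[0,\infty]$-valued) Hausdorff distance. (b) There exists $\bar x\in S(\bar b,\bar\lambda)$ such that $A\bar x\neq\bar b$ and $\bar b\notin\operatorname{rge}(A_{J(\bar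 x)})$, where $$J(\bar x)=\Big\{i\in\{1,\dots,n\}:\Big|A_i^T\frac{\bar b-A\bar x}{\|A\bar x-\bar b\|}\Big|=\bar\lambda\Big\},$$ $A_{J}$ is the matrix formed by the columns $A_i$ with $i\in J$, and $\operatorname{rge}(A_J)$ is its range (with $\operatorname{rge}(A_\emptyset)=\{0\}$). -/

import Mathlib

noncomputable section

namespace SRLasso

/-- A set-valued map `F` is locally (Hausdorff) Lipschitz at `x₀`: there are `δ, L ∈ (0, ∞)` such
that `d_H (F x, F x') ≤ L * dist x x'` for all `x, x'` in the open ball of radius `δ` around `x₀`.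
The Hausdorff distance takes values in `[0, ∞]`; it is `∞` between an empty and a nonempty set. -/
def LocallyHausdorffLipschitzAt {X Y : Type*} [PseudoMetricSpace X] [PseudoEMetricSpace Y]
    (F : X → Set Y) (x₀ : X) : Prop :=
  ∃ δ : ℝ, 0 < δ ∧ ∃ L : ℝ, 0 < L ∧ ∀ x ∈ Metric.ball x₀ δ, ∀ x' ∈ Metric.ball x₀ δ,
    Metric.hausdorffEDist (F x) (F x') ≤ ENNReal.ofReal (L * dist x x')

variable {m n : ℕ}

/-- The product `A x`, as a vector of the Euclidean space `ℝᵐ`. -/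
abbrev mulVec (A : Matrix (Fin m) (Fin n) ℝ) (x : EuclideanSpace ℝ (Fin n)) :
    EuclideanSpace ℝ (Fin m) :=
  Matrix.toEuclideanLin A x

/-- The SR-LASSO objective `‖A x - b‖₂ + lam * ‖x‖₁`. -/
def objective (A : Matrix (Fin m) (Fin n) ℝ) (b : EuclideanSpace ℝ (Fin m)) (lam : ℝ)
    (x : EuclideanSpace ℝ (Fin n)) : ℝ :=
  ‖mulVec A x - b‖ + lam * ∑ i, |x i|

/-- The set `S(b, lam)` of global minimizers of the SR-LASSO objective. -/
def solutionSet (A : Matrix (Fin m) (Fin n) ℝ) (b : EuclideanSpace ℝ (Fin m)) (lam : ℝ) :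
    Set (EuclideanSpace ℝ (Fin n)) :=
  {x | ∀ z, objective A b lam x ≤ objective A b lam z}

/-- The solution mapping `(b, lam) ↦ S(b, lam)` on `ℝᵐ × ℝ` with the Euclidean norm. -/
def solutionMap (A : Matrix (Fin m) (Fin n) ℝ) (p : WithLp 2 (EuclideanSpace ℝ (Fin m) × ℝ)) :
    Set (EuclideanSpace ℝ (Fin n)) :=
  solutionSet A p.fst p.snd

/-- The index set `J(x) = {i : |A_iᵀ ((b - A x) / ‖A x - b‖)| = lam}`, where `A_i` is the `i`-th
column of `A` (used only at points with `A x ≠ b`). -/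
def activeSet (A : Matrix (Fin m) (Fin n) ℝ) (b : EuclideanSpace ℝ (Fin m)) (lam : ℝ)
    (x : EuclideanSpace ℝ (Fin n)) : Finset (Fin n) :=
  {i | |A.col i ⬝ᵥ (‖mulVec A x - b‖⁻¹ • (b - mulVec A x)).ofLp| = lam}

/-- The range of the matrix `A_J` formed by the columns of `A` with index in `J`. -/
def colRange (A : Matrix (Fin m) (Fin n) ℝ) (J : Finset (Fin n)) :
    Submodule ℝ (EuclideanSpace ℝ (Fin m)) :=
  LinearMap.range (Matrix.toEuclideanLin (A.submatrix id (Subtype.val : J → Fin n)))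

end SRLasso

end

/-! Write `y` for the normalized residual of a solution `x` and `r` for its residual norm, so that
`b = A x + r y`. Optimality with `r > 0` says that `Aᵀ y` is a subgradient of `lam ‖·‖₁` at `x`; in
particular `x` is supported on the active set `J`.

Sufficiency. If `b` is not in the range of `A_J`, all solutions share one image, and some linear
functional `f` kills that range with `f b = 1`. By outer semicontinuity, nearby solutions are still
supported on `J`, so `f (A x) = 0` and `r * f y = f b`: the vector `y` determines `r`. Monotonicity
of the subdifferential bounds `‖y - y'‖²` by the data difference times first-order terms, so `y`,
then `r`, `A x` and `‖x‖₁`, are Lipschitz (`IsRegular.exists_lipschitz`). The objective sees `x`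
only through `A x` and `‖x‖₁`, so Hoffman's bound for the polyhedron of points with prescribed image
and bounded `ℓ¹` norm turns this into a Hausdorff estimate.

Necessity. If `b` is in the range of `A_J` for a solution with nonzero residual, an arbitrarily
small perturbation of `b` makes every sign on `J` strict, and the solution can then slide along the
ray of `y`, changing its `ℓ¹` norm (`exists_l1_lt_of_mem_colRange`). But `‖x‖₁` decreases in `lam`,
so such a spread is a jump between the solution sets for slightly smaller and slightly larger `lam`,
which a Lipschitz map excludes (`l1_le_of_hausdorffLipschitz`). -/

/-! ### Finitely generated cones, Farkas' lemma and Hoffman's bound -/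

open Finset in
/-- **Conic Carathéodory theorem**: a nonnegative combination of a finite family is a nonnegative
combination of a linearly independent subfamily. -/
theorem exists_linearIndepOn_nonneg_combination {ι E : Type*} [AddCommGroup E] [Module ℝ E]
    (a : ι → E) (t : Finset ι) (μ : ι → ℝ) (hμ : ∀ i ∈ t, 0 ≤ μ i) :
    ∃ s ⊆ t, ∃ ν : ι → ℝ, (∀ i ∈ s, 0 ≤ ν i) ∧ ∑ i ∈ s, ν i • a i = ∑ i ∈ t, μ i • a i ∧
      LinearIndepOn ℝ a (s : Set ι) := by
  classical
  induction t using Finset.strongInduction generalizing μ with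
  | H t ih =>
  by_cases hli : LinearIndepOn ℝ a (t : Set ι)
  · exact ⟨t, Subset.rfl, μ, hμ, rfl, hli⟩
  obtain ⟨g, hg0, j, hj, hgj⟩ : ∃ g : ι → ℝ, ∑ i ∈ t, g i • a i = 0 ∧ ∃ j ∈ t, 0 < g j := by
    rw [linearIndepOn_finset_iff] at hli
    push Not at hli
    obtain ⟨g, hg, j, hj, hgj⟩ := hli
    rcases hgj.lt_or_gt with h | h
    · exact ⟨-g, by simp [hg], j, hj, by simpa using h⟩
    · exact ⟨g, hg, j, hj, h⟩
  obtain ⟨k, hk, hmin⟩ := exists_min_image {i ∈ t | 0 < g i} (fun i => μ i / g i)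
    ⟨j, mem_filter.2 ⟨hj, hgj⟩⟩
  rw [mem_filter] at hk
  -- The largest multiple of the relation `g` that can be subtracted with all coefficients staying
  -- nonnegative; it annihilates the one at `k`.
  set c := μ k / g k with hc
  have hc0 : 0 ≤ c := div_nonneg (hμ k hk.1) hk.2.le
  have hk0 : μ k - c * g k = 0 := by rw [hc, div_mul_cancel₀ _ hk.2.ne', sub_self]
  obtain ⟨s, hs, ν, hν, hsum, hind⟩ := ih (t.erase k) (erase_ssubset hk.1)
    (fun i => μ i - c * g i) (by
      intro i hi
      have hit := mem_of_mem_erase hi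
      by_cases hgi : 0 < g i
      · have := hmin i (mem_filter.2 ⟨hit, hgi⟩)
        rw [le_div_iff₀ hgi] at this
        linarith
      · have := hμ i hit
        nlinarith)
  refine ⟨s, hs.trans (erase_subset _ _), ν, hν, ?_, hind⟩
  rw [hsum, sum_erase _ (by rw [hk0, zero_smul])]
  simp [sub_smul, mul_smul, ← smul_sum, hg0]

/-- The coefficients of a combination of a linearly independent finite family are controlled by the
norm of the combination. -/
theorem LinearIndepOn.exists_sum_abs_le {ι E : Type*} [NormedAddCommGroup E] [NormedSpace ℝ E]
    {a : ι → E} {s : Finset ι} (h : LinearIndepOn ℝ a (s : Set ι)) :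
    ∃ C : ℝ, 0 ≤ C ∧ ∀ ν : ι → ℝ, ∑ i ∈ s, |ν i| ≤ C * ‖∑ i ∈ s, ν i • a i‖ := by
  have hinj : LinearMap.ker (Fintype.linearCombination ℝ (fun i : s => a i)) = ⊥ :=
    LinearMap.ker_eq_bot.2 (linearIndependent_iff_injective_fintypeLinearCombination.1 h)
  obtain ⟨K, -, hK⟩ := LinearMap.exists_antilipschitzWith _ hinj
  refine ⟨s.card * K, by positivity, fun ν => ?_⟩
  have h1 := hK.le_mul_norm (map_zero _) (fun i : s => ν i)
  rw [Fintype.linearCombination_apply] at h1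
  rw [Finset.sum_coe_sort s (fun i => ν i • a i)] at h1
  calc ∑ i ∈ s, |ν i| ≤ ∑ i ∈ s, K * ‖∑ i ∈ s, ν i • a i‖ :=
        Finset.sum_le_sum fun i hi =>
          (norm_le_pi_norm (fun i : s => ν i) ⟨i, hi⟩).trans h1
    _ = _ := by rw [Finset.sum_const, nsmul_eq_mul, mul_assoc]

/-- A finitely generated convex cone is closed. -/
theorem isClosed_nonneg_combinations {ι E : Type*} [NormedAddCommGroup E] [NormedSpace ℝ E]
    (a : ι → E) (t : Finset ι) :
    IsClosed {v : E | ∃ μ : ι → ℝ, (∀ i ∈ t, 0 ≤ μ i) ∧ ∑ i ∈ t, μ i • a i = v} := by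
  classical
  -- By Carathéodory the cone is a finite union of images of orthants under injective linear maps,
  -- which are closed embeddings.
  have : {v : E | ∃ μ : ι → ℝ, (∀ i ∈ t, 0 ≤ μ i) ∧ ∑ i ∈ t, μ i • a i = v} =
      ⋃ (s : Finset ι) (_ : s ∈ t.powerset.filter fun s : Finset ι => LinearIndepOn ℝ a (s : Set ι)),
        Fintype.linearCombination ℝ (fun i : s => a i) '' {μ | ∀ i, 0 ≤ μ i} := by
    ext v
    simp only [Set.mem_ofPred_eq, Finset.mem_filter, Finset.mem_powerset, Set.mem_iUnion,
      Set.mem_image, exists_prop, Fintype.linearCombination_apply]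
    constructor
    · rintro ⟨μ, hμ, rfl⟩
      obtain ⟨s, hs, ν, hν, hsum, hind⟩ := exists_linearIndepOn_nonneg_combination a t μ hμ
      exact ⟨s, ⟨hs, hind⟩, fun i => ν i, fun i => hν i i.2, by
        rw [← hsum, Finset.sum_coe_sort s (fun i => ν i • a i)]⟩
    · rintro ⟨s, ⟨hs, -⟩, ν, hν, rfl⟩
      refine ⟨fun i => if h : i ∈ s then ν ⟨i, h⟩ else 0, fun i _ => ?_, ?_⟩
      · dsimp only
        split_ifs with h
        exacts [hν _, le_rfl]
      · rw [← Finset.sum_subset hs (by intro i _ hi; simp [hi]), ← Finset.sum_coe_sort]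
        simp
  rw [this]
  refine Set.Finite.isClosed_biUnion (Finset.finite_toSet _) fun s hs => ?_
  have hind := (Finset.mem_filter.1 hs).2
  refine (LinearMap.isClosedEmbedding_of_injective (LinearMap.ker_eq_bot.2
    (linearIndependent_iff_injective_fintypeLinearCombination.1 hind))).isClosedMap _ ?_
  simp only [Set.ofPred_forall]
  exact isClosed_iInter fun i => isClosed_le continuous_const (continuous_apply i)

open scoped InnerProductSpace in
/-- **Farkas' lemma** for a finite family in a Hilbert space. -/
theorem exists_nonneg_combination_of_forall_inner_nonpos {ι E : Type*} [NormedAddCommGroup E]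
    [InnerProductSpace ℝ E] [CompleteSpace E] (a : ι → E) (t : Finset ι) (v : E)
    (h : ∀ d : E, (∀ i ∈ t, ⟪a i, d⟫_ℝ ≤ 0) → ⟪v, d⟫_ℝ ≤ 0) :
    ∃ μ : ι → ℝ, (∀ i ∈ t, 0 ≤ μ i) ∧ ∑ i ∈ t, μ i • a i = v := by
  classical
  by_contra hv
  set K := {v : E | ∃ μ : ι → ℝ, (∀ i ∈ t, 0 ≤ μ i) ∧ ∑ i ∈ t, μ i • a i = v} with hK
  have hconv : Convex ℝ K := by
    rintro _ ⟨μ, hμ, rfl⟩ _ ⟨ν, hν, rfl⟩ c d hc hd -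
    refine ⟨fun i => c * μ i + d * ν i, fun i hi => ?_, ?_⟩
    · exact add_nonneg (mul_nonneg hc (hμ i hi)) (mul_nonneg hd (hν i hi))
    · simp [add_smul, mul_smul, Finset.sum_add_distrib, Finset.smul_sum]
  obtain ⟨f, u, hf, hu⟩ :=
    geometric_hahn_banach_closed_point hconv (isClosed_nonneg_combinations a t) hv
  have hf' : ∀ w, ⟪w, (InnerProductSpace.toDual ℝ E).symm f⟫_ℝ = f w := fun w => by
    rw [real_inner_comm, InnerProductSpace.toDual_symm_apply]
  have hu0 : 0 < u := by simpa using hf 0 ⟨0, by simp, by simp⟩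
  refine absurd (h ((InnerProductSpace.toDual ℝ E).symm f) fun i hi => ?_) ?_
  · rw [hf']
    by_contra! hpos
    -- If `f` were positive on a generator, rescaling it within the cone would reach the value `u`.
    have := hf ((u / f (a i)) • a i) ⟨Pi.single i (u / f (a i)), fun j _ => ?_, ?_⟩
    · rw [map_smul, smul_eq_mul, div_mul_cancel₀ _ hpos.ne'] at this
      exact lt_irrefl _ this
    · rw [Pi.single_apply]
      split_ifs
      exacts [(div_pos hu0 hpos).le, le_rfl]
    · rw [Finset.sum_eq_single i (fun j _ hj => by simp [hj]) (fun h => absurd hi h)]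
      simp
  · rw [hf', not_le]
    exact hu0.trans hu

open scoped InnerProductSpace in
/-- **Hoffman's error bound**: the distance of a point to a nonempty polyhedron is bounded by a
multiple of the violation of the inequalities, uniformly in the right-hand side. -/
theorem exists_hoffman_bound {ι E : Type*} [Finite ι] [NormedAddCommGroup E]
    [InnerProductSpace ℝ E] [FiniteDimensional ℝ E] (a : ι → E) :
    ∃ H : ℝ, 0 ≤ H ∧ ∀ (q : ι → ℝ) (ε : ℝ) (x : E), (∃ z, ∀ i, ⟪a i, z⟫_ℝ ≤ q i) →
      (∀ i, ⟪a i, x⟫_ℝ ≤ q i + ε) → 0 ≤ ε →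
      ∃ z, (∀ i, ⟪a i, z⟫_ℝ ≤ q i) ∧ ‖x - z‖ ≤ H * ε := by
  classical
  cases nonempty_fintype ι
  have hC : ∀ s : Finset ι, ∃ C : ℝ, 0 ≤ C ∧ (LinearIndepOn ℝ a (s : Set ι) → ∀ ν : ι → ℝ,
      ∑ i ∈ s, |ν i| ≤ C * ‖∑ i ∈ s, ν i • a i‖) := fun s => by
    by_cases h : LinearIndepOn ℝ a (s : Set ι)
    · obtain ⟨C, h0, h1⟩ := h.exists_sum_abs_le
      exact ⟨C, h0, fun _ => h1⟩
    · exact ⟨0, le_rfl, fun h' => absurd h' h⟩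
  choose C hC0 hC using hC
  -- The sum dominates the constant of whichever independent subfamily occurs below, so the bound
  -- does not depend on `q`.
  refine ⟨∑ s, C s, Finset.sum_nonneg fun s _ => hC0 s, fun q ε x hne hx hε => ?_⟩
  have hclosed : IsClosed {z : E | ∀ i, ⟪a i, z⟫_ℝ ≤ q i} := by
    simp only [Set.ofPred_forall]
    exact isClosed_iInter fun i => isClosed_le (by fun_prop) continuous_const
  have hconv : Convex ℝ {z : E | ∀ i, ⟪a i, z⟫_ℝ ≤ q i} := by
    intro y hy z hz c d hc hd hcd i
    have h1 := mul_le_mul_of_nonneg_left (hy i) hc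
    have h2 := mul_le_mul_of_nonneg_left (hz i) hd
    rw [inner_add_right, inner_smul_right, inner_smul_right]
    calc _ ≤ c * q i + d * q i := add_le_add h1 h2
      _ = q i := by rw [← add_mul, hcd, one_mul]
  obtain ⟨z, hz, hzmin⟩ := exists_norm_eq_iInf_of_complete_convex hne hclosed.isComplete hconv x
  have hproj := (norm_eq_iInf_iff_real_inner_le_zero hconv hz).1 hzmin
  refine ⟨z, hz, ?_⟩
  set t : Finset ι := {i | ⟪a i, z⟫_ℝ = q i} with ht
  -- With `z` the projection of `x`, the vector `x - z` lies in the cone of the active normals: a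
  -- direction `d` nonpositive on them stays feasible for a short time, so the projection inequality
  -- applies to it.
  obtain ⟨μ, hμ, hsum⟩ := exists_nonneg_combination_of_forall_inner_nonpos a t (x - z) (by
    intro d hd
    obtain ⟨τ, hτ, hfeas⟩ : ∃ τ : ℝ, 0 < τ ∧ ∀ i, ⟪a i, z + τ • d⟫_ℝ ≤ q i := by
      have : ∀ i, ∀ᶠ τ : ℝ in nhdsWithin 0 (Set.Ioi 0), ⟪a i, z + τ • d⟫_ℝ ≤ q i := by
        intro i
        by_cases hi : i ∈ t
        · filter_upwards [self_mem_nhdsWithin] with τ hτ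
          rw [inner_add_right, inner_smul_right, (Finset.mem_filter.1 hi).2]
          have := mul_nonpos_of_nonneg_of_nonpos (le_of_lt (Set.mem_Ioi.1 hτ)) (hd i hi)
          linarith
        · have hlt : ⟪a i, z⟫_ℝ < q i :=
            lt_of_le_of_ne (hz i) fun h => hi (Finset.mem_filter.2 ⟨Finset.mem_univ _, h⟩)
          have hcont : Continuous fun τ : ℝ => ⟪a i, z + τ • d⟫_ℝ := by fun_prop
          have := (hcont.tendsto 0).eventually_lt_const (u := q i) (by simpa using hlt)
          filter_upwards [nhdsWithin_le_nhds this] with τ hτ using hτ.le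
      obtain ⟨τ, h1, h2⟩ := ((Filter.eventually_all.2 this).and self_mem_nhdsWithin).exists
      exact ⟨τ, h2, h1⟩
    have := hproj _ hfeas
    rw [add_sub_cancel_left, inner_smul_right] at this
    exact nonpos_of_mul_nonpos_right this hτ)
  obtain ⟨s, hst, ν, hν, hsum', hind⟩ := exists_linearIndepOn_nonneg_combination a t μ hμ
  rw [hsum] at hsum'
  have hbd := hC s hind ν
  rw [hsum'] at hbd
  have hsq : ‖x - z‖ * ‖x - z‖ ≤ (C s * ε) * ‖x - z‖ := by
    calc ‖x - z‖ * ‖x - z‖ = ⟪∑ i ∈ s, ν i • a i, x - z⟫_ℝ := by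
          rw [hsum', real_inner_self_eq_norm_mul_norm]
      _ = ∑ i ∈ s, ν i * ⟪a i, x - z⟫_ℝ := by simp [sum_inner, inner_smul_left]
      _ ≤ ∑ i ∈ s, |ν i| * ε := by
          refine Finset.sum_le_sum fun i hi => ?_
          have h1 : ⟪a i, z⟫_ℝ = q i := (Finset.mem_filter.1 (hst hi)).2
          rw [abs_of_nonneg (hν i hi), inner_sub_right, h1]
          exact mul_le_mul_of_nonneg_left (by linarith [hx i]) (hν i hi)
      _ = (∑ i ∈ s, |ν i|) * ε := by rw [Finset.sum_mul]
      _ ≤ (C s * ‖x - z‖) * ε := mul_le_mul_of_nonneg_right hbd hε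
      _ = _ := by ring
  have hCs : C s ≤ ∑ s, C s := Finset.single_le_sum (fun s _ => hC0 s) (Finset.mem_univ s)
  refine le_trans ?_ (mul_le_mul_of_nonneg_right hCs hε)
  rcases (norm_nonneg (x - z)).eq_or_lt with h | h
  · rw [← h]
    exact mul_nonneg (hC0 s) hε
  · exact le_of_mul_le_mul_right hsq h

open scoped InnerProductSpace
open Filter Topology

namespace SRLasso

variable {m n : ℕ}

/-! ### The `ℓ¹` norm and dual certificates -/

/-- The `ℓ¹` norm on Euclidean space. -/
def l1 (x : EuclideanSpace ℝ (Fin n)) : ℝ := ∑ i, |x i|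

/-- The correlation of `y` with the `i`-th column of `A`. -/
def corr (A : Matrix (Fin m) (Fin n) ℝ) (y : EuclideanSpace ℝ (Fin m)) (i : Fin n) : ℝ :=
  A.col i ⬝ᵥ y.ofLp

/-- `y` certifies that `A x` is dual to `y` with respect to `lam` times the `ℓ¹` norm: `Aᵀ y` lies
in the subdifferential of `lam * ‖·‖₁` at `x`. -/
structure IsDual (A : Matrix (Fin m) (Fin n) ℝ) (lam : ℝ) (x : EuclideanSpace ℝ (Fin n))
    (y : EuclideanSpace ℝ (Fin m)) : Prop where
  le : ∀ z, ⟪y, mulVec A z⟫_ℝ ≤ lam * l1 z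
  eq : ⟪y, mulVec A x⟫_ℝ = lam * l1 x

theorem l1_nonneg (x : EuclideanSpace ℝ (Fin n)) : 0 ≤ l1 x :=
  Finset.sum_nonneg fun _ _ => abs_nonneg _

theorem l1_zero : l1 (0 : EuclideanSpace ℝ (Fin n)) = 0 := by simp [l1]

theorem l1_add_le (x y : EuclideanSpace ℝ (Fin n)) : l1 (x + y) ≤ l1 x + l1 y := by
  rw [l1, l1, l1, ← Finset.sum_add_distrib]
  exact Finset.sum_le_sum fun i _ => abs_add_le _ _

theorem l1_smul (c : ℝ) (x : EuclideanSpace ℝ (Fin n)) : l1 (c • x) = |c| * l1 x := by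
  simp [l1, Finset.mul_sum, abs_mul]

theorem continuous_l1 : Continuous (l1 : EuclideanSpace ℝ (Fin n) → ℝ) := by
  unfold l1
  fun_prop

theorem l1_le_mul_norm (x : EuclideanSpace ℝ (Fin n)) : l1 x ≤ n * ‖x‖ := by
  calc l1 x ≤ ∑ _i : Fin n, ‖x‖ := Finset.sum_le_sum fun i _ => PiLp.norm_apply_le x i
    _ = _ := by simp

theorem norm_le_l1 (x : EuclideanSpace ℝ (Fin n)) : ‖x‖ ≤ l1 x := by
  refine le_of_sq_le_sq ?_ (l1_nonneg x)
  rw [EuclideanSpace.norm_sq_eq]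
  exact Finset.sum_sq_le_sq_sum_of_nonneg fun _ _ => abs_nonneg _

theorem l1_sub_le (x y : EuclideanSpace ℝ (Fin n)) : l1 x - l1 y ≤ n * ‖x - y‖ := by
  have h := l1_add_le (x - y) y
  rw [sub_add_cancel] at h
  linarith [l1_le_mul_norm (x - y)]

theorem objective_eq (A : Matrix (Fin m) (Fin n) ℝ) (b : EuclideanSpace ℝ (Fin m)) (lam : ℝ)
    (x : EuclideanSpace ℝ (Fin n)) : objective A b lam x = ‖mulVec A x - b‖ + lam * l1 x := rfl

theorem continuous_mulVec (A : Matrix (Fin m) (Fin n) ℝ) : Continuous (mulVec A) :=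
  LinearMap.continuous_of_finiteDimensional _

theorem inner_mulVec (A : Matrix (Fin m) (Fin n) ℝ) (y : EuclideanSpace ℝ (Fin m))
    (x : EuclideanSpace ℝ (Fin n)) : ⟪y, mulVec A x⟫_ℝ = ∑ i, x i * corr A y i := by
  rw [EuclideanSpace.inner_eq_star_dotProduct]
  simp only [mulVec, Matrix.ofLp_toLpLin, Matrix.toLin'_apply, star_trivial]
  rw [dotProduct_comm, Matrix.dotProduct_mulVec, dotProduct_comm]
  simp only [dotProduct, corr, Matrix.vecMul, Matrix.col_apply]
  refine Finset.sum_congr rfl fun i _ => ?_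
  congr 1
  exact Finset.sum_congr rfl fun j _ => mul_comm _ _

theorem corr_smul (A : Matrix (Fin m) (Fin n) ℝ) (c : ℝ) (y : EuclideanSpace ℝ (Fin m))
    (i : Fin n) : corr A (c • y) i = c * corr A y i := by
  simp [corr]

theorem continuous_corr (A : Matrix (Fin m) (Fin n) ℝ) (i : Fin n) :
    Continuous fun y => corr A y i := by
  unfold corr dotProduct
  fun_prop

theorem isDual_iff {A : Matrix (Fin m) (Fin n) ℝ} {lam : ℝ}
    {x : EuclideanSpace ℝ (Fin n)} {y : EuclideanSpace ℝ (Fin m)} :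
    IsDual A lam x y ↔ (∀ i, |corr A y i| ≤ lam) ∧ ∀ i, x i * corr A y i = lam * |x i| := by
  have key : (∀ i, |corr A y i| ≤ lam) → ∀ (z : EuclideanSpace ℝ (Fin n)) (i : Fin n),
      z i * corr A y i ≤ lam * |z i| := fun h z i => by
    calc z i * corr A y i ≤ |z i * corr A y i| := le_abs_self _
      _ = |corr A y i| * |z i| := by rw [abs_mul, mul_comm]
      _ ≤ _ := mul_le_mul_of_nonneg_right (h i) (abs_nonneg _)
  constructor
  · intro h
    have hb : ∀ i, |corr A y i| ≤ lam := fun i => by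
      have h1 := h.le (EuclideanSpace.single i 1)
      have h2 := h.le (-EuclideanSpace.single i 1)
      rw [inner_mulVec] at h1 h2
      simp only [l1, PiLp.neg_apply, PiLp.single_apply, ite_mul, one_mul, zero_mul,
        Finset.sum_ite_eq', Finset.mem_univ, if_true, neg_mul, Finset.sum_neg_distrib, abs_neg,
        apply_ite abs, abs_one, abs_zero, mul_one] at h1 h2
      exact abs_le.2 ⟨by linarith, h1⟩
    have h3 := h.eq
    rw [inner_mulVec, l1, Finset.mul_sum, Finset.sum_eq_sum_iff_of_le fun i _ => key hb x i] at h3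
    exact ⟨hb, fun i => h3 i (Finset.mem_univ i)⟩
  · rintro ⟨hb, he⟩
    refine ⟨fun z => ?_, ?_⟩
    · rw [inner_mulVec, l1, Finset.mul_sum]
      exact Finset.sum_le_sum fun i _ => key hb z i
    · rw [inner_mulVec, l1, Finset.mul_sum]
      exact Finset.sum_congr rfl fun i _ => he i

/-! ### First-order optimality conditions -/

/-- The normalized residual `(b - A x) / ‖A x - b‖`. -/
noncomputable def dualVec (A : Matrix (Fin m) (Fin n) ℝ) (b : EuclideanSpace ℝ (Fin m))
    (x : EuclideanSpace ℝ (Fin n)) : EuclideanSpace ℝ (Fin m) :=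
  ‖mulVec A x - b‖⁻¹ • (b - mulVec A x)

theorem mem_activeSet {A : Matrix (Fin m) (Fin n) ℝ} {b : EuclideanSpace ℝ (Fin m)} {lam : ℝ}
    {x : EuclideanSpace ℝ (Fin n)} {i : Fin n} :
    i ∈ activeSet A b lam x ↔ |corr A (dualVec A b x) i| = lam := by
  simp [activeSet, corr, dualVec]

theorem norm_dualVec {A : Matrix (Fin m) (Fin n) ℝ} {b : EuclideanSpace ℝ (Fin m)}
    {x : EuclideanSpace ℝ (Fin n)} (h : mulVec A x ≠ b) : ‖dualVec A b x‖ = 1 := by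
  have : ‖mulVec A x - b‖ ≠ 0 := norm_ne_zero_iff.2 (sub_ne_zero.2 h)
  rw [dualVec, norm_smul, norm_inv, norm_norm, norm_sub_rev b, inv_mul_cancel₀ this]

theorem norm_smul_dualVec {A : Matrix (Fin m) (Fin n) ℝ} {b : EuclideanSpace ℝ (Fin m)}
    {x : EuclideanSpace ℝ (Fin n)} (h : mulVec A x ≠ b) :
    ‖mulVec A x - b‖ • dualVec A b x = b - mulVec A x := by
  have : ‖mulVec A x - b‖ ≠ 0 := norm_ne_zero_iff.2 (sub_ne_zero.2 h)
  rw [dualVec, smul_smul, mul_inv_cancel₀ this, one_smul]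

/-- First-order necessary optimality condition for the SR-LASSO at points with nonzero residual. -/
theorem isDual_dualVec {A : Matrix (Fin m) (Fin n) ℝ} {b : EuclideanSpace ℝ (Fin m)} {lam : ℝ}
    (hlam : 0 ≤ lam) {x : EuclideanSpace ℝ (Fin n)} (hx : x ∈ solutionSet A b lam)
    (h : mulVec A x ≠ b) : IsDual A lam x (dualVec A b x) := by
  have hr : 0 < ‖mulVec A x - b‖ := norm_pos_iff.2 (sub_ne_zero.2 h)
  have main : ∀ z, ⟪dualVec A b x, mulVec A z - mulVec A x⟫_ℝ ≤ lam * (l1 z - l1 x) := by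
    intro z
    set u := mulVec A x - b with hu
    set w := mulVec A z - mulVec A x with hw
    have hy : dualVec A b x = -(‖u‖⁻¹ • u) := by rw [dualVec, ← smul_neg, hu, neg_sub]
    have step : ∀ s : ℝ, 0 < s → s ≤ 1 →
        0 ≤ ⟪u, w⟫_ℝ / ‖u‖ + lam * (l1 z - l1 x) + s * (‖w‖ ^ 2 / (2 * ‖u‖)) := by
      intro s hs hs1
      have h1 := hx (x + s • (z - x))
      have h2 : mulVec A (x + s • (z - x)) - b = u + s • w := by
        simp only [mulVec, map_add, map_smul, map_sub, hu, hw]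
        abel
      rw [objective_eq, objective_eq, h2] at h1
      have h3 : l1 (x + s • (z - x)) ≤ (1 - s) * l1 x + s * l1 z := by
        have h4 := l1_add_le ((1 - s) • x) (s • z)
        rw [l1_smul, l1_smul, abs_of_pos hs, abs_of_nonneg (sub_nonneg.2 hs1)] at h4
        convert h4 using 2
        module
      have h5 : ‖u + s • w‖ ^ 2 = ‖u‖ ^ 2 + 2 * (s * ⟪u, w⟫_ℝ) + s ^ 2 * ‖w‖ ^ 2 := by
        rw [norm_add_sq_real, inner_smul_right, norm_smul, mul_pow, Real.norm_eq_abs, sq_abs]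
      -- From `2 ‖u‖ (p - ‖u‖) ≤ p² - ‖u‖²` with `p = ‖u + s • w‖`.
      have h6 : ‖u + s • w‖ - ‖u‖ ≤ s * (⟪u, w⟫_ℝ / ‖u‖ + s * (‖w‖ ^ 2 / (2 * ‖u‖))) := by
        have : s * (⟪u, w⟫_ℝ / ‖u‖ + s * (‖w‖ ^ 2 / (2 * ‖u‖)))
            = (‖u + s • w‖ ^ 2 - ‖u‖ ^ 2) / (2 * ‖u‖) := by
          rw [h5]
          field_simp
          ring
        rw [this, le_div_iff₀ (by positivity)]
        nlinarith [sq_nonneg (‖u + s • w‖ - ‖u‖)]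
      have h7 := mul_le_mul_of_nonneg_left h3 hlam
      refine (mul_nonneg_iff_of_pos_left hs).1 ?_
      linarith
    have hlim : 0 ≤ ⟪u, w⟫_ℝ / ‖u‖ + lam * (l1 z - l1 x) := by
      have ht : Tendsto (fun s : ℝ => ⟪u, w⟫_ℝ / ‖u‖ + lam * (l1 z - l1 x)
          + s * (‖w‖ ^ 2 / (2 * ‖u‖))) (𝓝[>] 0) (𝓝 (⟪u, w⟫_ℝ / ‖u‖ + lam * (l1 z - l1 x))) := by
        have hc : Continuous (fun s : ℝ => ⟪u, w⟫_ℝ / ‖u‖ + lam * (l1 z - l1 x)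
          + s * (‖w‖ ^ 2 / (2 * ‖u‖))) := by fun_prop
        simpa using (hc.tendsto 0).mono_left nhdsWithin_le_nhds
      refine ge_of_tendsto ht ?_
      filter_upwards [Ioc_mem_nhdsGT (zero_lt_one (α := ℝ))] with s hs using step s hs.1 hs.2
    rw [hy, inner_neg_left, real_inner_smul_left, inv_mul_eq_div]
    linarith
  -- The test points `0` and `2x` give the two opposite inequalities behind the equality `he`.
  have h0 := main 0
  have h2 := main ((2 : ℝ) • x)
  rw [l1_smul] at h2
  simp only [mulVec, map_zero, map_smul, l1_zero, inner_sub_right, inner_zero_right,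
    real_inner_smul_right, Nat.abs_ofNat] at h0 h2
  have he : ⟪dualVec A b x, mulVec A x⟫_ℝ = lam * l1 x := by
    simp only [mulVec]
    linarith
  refine ⟨fun z => ?_, he⟩
  have := main z
  rw [inner_sub_right, he] at this
  linarith

/-- First-order sufficient optimality condition for the SR-LASSO. -/
theorem mem_solutionSet_of_isDual {A : Matrix (Fin m) (Fin n) ℝ} {b : EuclideanSpace ℝ (Fin m)}
    {lam r : ℝ} {x : EuclideanSpace ℝ (Fin n)} {y : EuclideanSpace ℝ (Fin m)}
    (hd : IsDual A lam x y) (hy : ‖y‖ = 1) (hr : 0 ≤ r) (hxy : b - mulVec A x = r • y) :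
    x ∈ solutionSet A b lam := by
  intro z
  rw [objective_eq, objective_eq, norm_sub_rev, hxy, norm_smul, hy, mul_one, Real.norm_eq_abs,
    abs_of_nonneg hr]
  have h1 : ⟪y, b - mulVec A z⟫_ℝ ≤ ‖mulVec A z - b‖ := by
    have := real_inner_le_norm y (b - mulVec A z)
    rwa [hy, one_mul, norm_sub_rev] at this
  have h2 : b = mulVec A x + r • y := by rw [← hxy]; abel
  have h3 : ⟪y, b⟫_ℝ = lam * l1 x + r := by
    rw [h2, inner_add_right, hd.eq, real_inner_smul_right, real_inner_self_eq_norm_sq, hy]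
    ring
  rw [inner_sub_right, h3] at h1
  linarith [hd.le z]

theorem mem_colRange_iff {A : Matrix (Fin m) (Fin n) ℝ} {J : Finset (Fin n)}
    {v : EuclideanSpace ℝ (Fin m)} :
    v ∈ colRange A J ↔ ∃ x : EuclideanSpace ℝ (Fin n), (∀ i ∉ J, x i = 0) ∧ mulVec A x = v := by
  have key : ∀ (x : EuclideanSpace ℝ (Fin n)), (∀ i ∉ J, x i = 0) →
      Matrix.toEuclideanLin (A.submatrix id (Subtype.val : J → Fin n))
        (WithLp.toLp 2 fun i : J => x i) = mulVec A x := by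
    intro x hx
    ext k
    simp only [mulVec, Matrix.ofLp_toLpLin, Matrix.toLin'_apply, Matrix.mulVec, dotProduct,
      Matrix.submatrix_apply, id]
    rw [Finset.sum_coe_sort J (fun i => A k i * x i)]
    exact Finset.sum_subset (Finset.subset_univ _) fun i _ hi => by rw [hx i hi, mul_zero]
  constructor
  · rintro ⟨u, rfl⟩
    refine ⟨WithLp.toLp 2 fun i => if h : i ∈ J then u ⟨i, h⟩ else 0, fun i hi => by simp [hi], ?_⟩
    rw [← key _ fun i hi => by simp [hi]]
    congr 1
    ext i
    simp
  · rintro ⟨x, hx, rfl⟩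
    exact ⟨_, key x hx⟩

/-! ### Existence, bounds and structure of solutions -/

theorem continuous_objective (A : Matrix (Fin m) (Fin n) ℝ) (b : EuclideanSpace ℝ (Fin m))
    (lam : ℝ) : Continuous (objective A b lam) := by
  have h1 := continuous_mulVec A
  have h2 := continuous_l1 (n := n)
  simp only [funext (objective_eq A b lam)]
  fun_prop

theorem solutionSet_nonempty (A : Matrix (Fin m) (Fin n) ℝ) (b : EuclideanSpace ℝ (Fin m))
    {lam : ℝ} (hlam : 0 < lam) : (solutionSet A b lam).Nonempty := by
  refine (continuous_objective A b lam).exists_forall_le ?_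
  refine tendsto_atTop_mono (f := fun x => lam * ‖x‖) (fun x => ?_)
    ((tendsto_norm_cocompact_atTop).const_mul_atTop hlam)
  rw [objective_eq]
  have := mul_le_mul_of_nonneg_left (norm_le_l1 x) hlam.le
  linarith [norm_nonneg (mulVec A x - b)]

theorem mul_norm_le_of_mem_solutionSet {A : Matrix (Fin m) (Fin n) ℝ}
    {b : EuclideanSpace ℝ (Fin m)} {lam : ℝ} (hlam : 0 ≤ lam) {x : EuclideanSpace ℝ (Fin n)}
    (hx : x ∈ solutionSet A b lam) : lam * ‖x‖ ≤ ‖b‖ := by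
  have h := hx 0
  rw [objective_eq, objective_eq, l1_zero, mulVec, mulVec, map_zero, zero_sub, norm_neg, mul_zero,
    add_zero] at h
  have := mul_le_mul_of_nonneg_left (norm_le_l1 x) hlam
  linarith [norm_nonneg (mulVec A x - b)]

/-- Adding the two optimality inequalities cancels the residual norms. -/
theorem l1_antitone_of_mem_solutionSet {A : Matrix (Fin m) (Fin n) ℝ}
    {b : EuclideanSpace ℝ (Fin m)} {l₁ l₂ : ℝ} (h : l₁ < l₂) {x z : EuclideanSpace ℝ (Fin n)}
    (hx : x ∈ solutionSet A b l₁) (hz : z ∈ solutionSet A b l₂) : l1 z ≤ l1 x := by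
  have h1 := hx z
  have h2 := hz x
  simp only [objective_eq] at h1 h2
  refine le_of_mul_le_mul_left (a := l₂ - l₁) ?_ (sub_pos.2 h)
  linarith

theorem IsDual.abs_corr_eq {A : Matrix (Fin m) (Fin n) ℝ} {lam : ℝ}
    {x : EuclideanSpace ℝ (Fin n)} {y : EuclideanSpace ℝ (Fin m)} (h : IsDual A lam x y)
    {i : Fin n} (hi : x i ≠ 0) : |corr A y i| = lam := by
  obtain ⟨hb, he⟩ := isDual_iff.1 h
  have h0 : 0 ≤ lam := (abs_nonneg _).trans (hb i)
  have h1 := congrArg abs (he i)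
  rw [abs_mul, abs_mul, abs_abs, abs_of_nonneg h0, mul_comm lam] at h1
  exact mul_left_cancel₀ (abs_ne_zero.2 hi) h1

theorem isDual_of_forall {A : Matrix (Fin m) (Fin n) ℝ} {lam : ℝ}
    {x : EuclideanSpace ℝ (Fin n)} {y : EuclideanSpace ℝ (Fin m)}
    (hb : ∀ i, |corr A y i| ≤ lam)
    (h : ∀ i, x i ≠ 0 → |corr A y i| = lam ∧ 0 ≤ x i * corr A y i) : IsDual A lam x y := by
  refine isDual_iff.2 ⟨hb, fun i => ?_⟩
  by_cases hi : x i = 0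
  · simp [hi]
  · obtain ⟨h1, h2⟩ := h i hi
    rw [← abs_of_nonneg h2, abs_mul, h1, mul_comm]

/-- If the target is not in the range of the active columns, then all solutions of the SR-LASSO
have the same image. -/
theorem mulVec_eq_of_notMem_colRange {A : Matrix (Fin m) (Fin n) ℝ}
    {b : EuclideanSpace ℝ (Fin m)} {lam : ℝ} (hlam : 0 ≤ lam) {x x' : EuclideanSpace ℝ (Fin n)}
    (hx : x ∈ solutionSet A b lam) (hx' : x' ∈ solutionSet A b lam) (hne : mulVec A x ≠ b)
    (hb : b ∉ colRange A (activeSet A b lam x)) : mulVec A x' = mulVec A x := by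
  have hd := isDual_dualVec hlam hx hne
  have hy := norm_dualVec hne
  have hr := norm_smul_dualVec hne
  have hJ : ∀ i ∉ activeSet A b lam x, |corr A (dualVec A b x) i| ≠ lam :=
    fun i hi h => hi (mem_activeSet.2 h)
  set y := dualVec A b x
  set r := ‖mulVec A x - b‖ with hrdef
  set r' := ‖mulVec A x' - b‖ with hr'def
  have hobj := le_antisymm (hx x') (hx' x)
  rw [objective_eq, objective_eq, ← hrdef, ← hr'def] at hobj
  have hb1 : ⟪y, b⟫_ℝ = lam * l1 x + r := by
    have : b = mulVec A x + r • y := by rw [hr]; abel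
    rw [this, inner_add_right, hd.eq, real_inner_smul_right, real_inner_self_eq_norm_sq, hy]
    ring
  have h1 : ⟪y, b - mulVec A x'⟫_ℝ ≤ r' := by
    have := real_inner_le_norm y (b - mulVec A x')
    rwa [hy, one_mul, norm_sub_rev] at this
  have h2 := hd.le x'
  have h3 : ⟪y, b - mulVec A x'⟫_ℝ = r' := by
    refine le_antisymm h1 ?_
    rw [inner_sub_right, hb1]
    linarith
  have h4 : ⟪y, mulVec A x'⟫_ℝ = lam * l1 x' := by
    rw [inner_sub_right, hb1] at h3
    linarith
  -- Equality in Cauchy–Schwarz: the residual of `x'` points along the same `y`.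
  have h5 : r' • y = b - mulVec A x' := by
    have := (inner_eq_norm_mul_iff_real (x := y) (y := b - mulVec A x')).1 (by
      rw [h3, hy, one_mul, norm_sub_rev])
    rwa [hy, one_smul, norm_sub_rev] at this
  have hd' : IsDual A lam x' y := ⟨hd.le, h4⟩
  by_contra hne'
  have hrr : r - r' ≠ 0 := fun h => hne' (by
    rw [sub_eq_zero] at h
    rw [← h, hr] at h5
    exact (sub_right_injective h5).symm)
  -- Eliminating `y` from `b = A x + r y = A x' + r' y` expresses `b` through `x` and `x'`, both
  -- supported on the active set.
  refine hb (mem_colRange_iff.2 ⟨(r - r')⁻¹ • (r • x' - r' • x), fun i hi => ?_, ?_⟩)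
  · have hxi : x i = 0 := by_contra fun h => hJ i hi (hd.abs_corr_eq h)
    have hxi' : x' i = 0 := by_contra fun h => hJ i hi (hd'.abs_corr_eq h)
    simp [hxi, hxi']
  · rw [mulVec, map_smul, inv_smul_eq_iff₀ hrr]
    have e1 : mulVec A x = b - r • y := by rw [hr]; abel
    have e2 : mulVec A x' = b - r' • y := by rw [h5]; abel
    calc mulVec A (r • x' - r' • x) = r • mulVec A x' - r' • mulVec A x := by
          simp only [mulVec, map_sub, map_smul]
      _ = (r - r') • b := by rw [e1, e2]; module

/-- The fibers of `A`, intersected with sublevel sets of the `ℓ¹` norm, depend on the data in a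
Lipschitz way. -/
theorem exists_l1_hoffman_bound (A : Matrix (Fin m) (Fin n) ℝ) :
    ∃ H : ℝ, 0 ≤ H ∧ ∀ (x x' : EuclideanSpace ℝ (Fin n)) (ε : ℝ),
      ‖mulVec A x - mulVec A x'‖ ≤ ε → l1 x ≤ l1 x' + ε →
      ∃ z, mulVec A z = mulVec A x' ∧ l1 z ≤ l1 x' ∧ ‖x - z‖ ≤ H * ε := by
  classical
  -- The `ℓ¹` bound is encoded by one linear inequality per sign pattern, and each equation of the
  -- fiber by two inequalities.
  let sgn : Finset (Fin n) → EuclideanSpace ℝ (Fin n) :=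
    fun s => WithLp.toLp 2 fun i => if i ∈ s then 1 else -1
  let row : Fin m → EuclideanSpace ℝ (Fin n) := fun k => WithLp.toLp 2 (A k)
  have hrow : ∀ k z, ⟪row k, z⟫_ℝ = mulVec A z k := fun k z => by
    simp [row, EuclideanSpace.inner_eq_star_dotProduct, Matrix.mulVec, mulVec,
      dotProduct_comm]
  have hsgn_eq : ∀ s z, ⟪sgn s, z⟫_ℝ = ∑ i, (if i ∈ s then 1 else -1) * z i := fun s z => by
    simp [sgn, EuclideanSpace.inner_eq_star_dotProduct, dotProduct, mul_comm]
  have hsgn : ∀ s z, ⟪sgn s, z⟫_ℝ ≤ l1 z := fun s z => by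
    rw [hsgn_eq]
    refine Finset.sum_le_sum fun i _ => ?_
    split_ifs
    · rw [one_mul]; exact le_abs_self _
    · rw [neg_one_mul]; exact neg_le_abs _
  have hl1 : ∀ z, ∃ s, ⟪sgn s, z⟫_ℝ = l1 z := fun z => by
    refine ⟨Finset.univ.filter fun i => 0 ≤ z i, ?_⟩
    rw [hsgn_eq]
    refine Finset.sum_congr rfl fun i _ => ?_
    by_cases hi : 0 ≤ z i
    · simp [hi, abs_of_nonneg hi]
    · simp [hi, abs_of_neg (not_le.1 hi)]
  obtain ⟨H, hH, hoff⟩ := exists_hoffman_bound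
    (Sum.elim sgn (Sum.elim row fun k => -row k) : Finset (Fin n) ⊕ (Fin m ⊕ Fin m) → _)
  refine ⟨H, hH, fun x x' ε hA hl => ?_⟩
  have habs : ∀ k, |mulVec A x k - mulVec A x' k| ≤ ε := fun k =>
    (PiLp.norm_apply_le (mulVec A x - mulVec A x') k).trans hA
  obtain ⟨z, hz, hxz⟩ := hoff (Sum.elim (fun _ => l1 x')
    (Sum.elim (fun k => mulVec A x' k) fun k => -mulVec A x' k)) ε x ⟨x', by
      rintro (s | k | k)
      · exact hsgn s x'
      · exact (hrow k x').le
      · simp only [Sum.elim_inr, inner_neg_left, hrow, le_refl]⟩ (by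
      rintro (s | k | k)
      · exact (hsgn s x).trans hl
      · simp only [Sum.elim_inr, Sum.elim_inl, hrow]
        linarith [le_of_abs_le (habs k)]
      · simp only [Sum.elim_inr, inner_neg_left, hrow]
        linarith [neg_le_of_abs_le (habs k)]) ((norm_nonneg _).trans hA)
  refine ⟨z, ?_, ?_, hxz⟩
  · ext k
    have h1 := hz (Sum.inr (Sum.inl k))
    have h2 := hz (Sum.inr (Sum.inr k))
    simp only [Sum.elim_inr, Sum.elim_inl, inner_neg_left, hrow] at h1 h2
    linarith
  · obtain ⟨s, hs⟩ := hl1 z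
    rw [← hs]
    exact hz (Sum.inl s)

/-! ### Lipschitz estimates for regular solutions -/

/-- Quantitative regularity of a pair `(b, lam)` and a solution `x`: the residual and the parameter
are bounded and bounded away from zero, and the functional `f` separates `b` from `A x`. -/
structure IsRegular (A : Matrix (Fin m) (Fin n) ℝ) (f : EuclideanSpace ℝ (Fin m) →L[ℝ] ℝ)
    (ρ R l Λ : ℝ) (b : EuclideanSpace ℝ (Fin m)) (lam : ℝ) (x : EuclideanSpace ℝ (Fin n)) :
    Prop where
  le_residual : ρ ≤ ‖mulVec A x - b‖
  residual_le : ‖mulVec A x - b‖ ≤ R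
  le_param : l ≤ lam
  param_le : lam ≤ Λ
  half_le : 1 / 2 ≤ f b
  map_eq_zero : f (mulVec A x) = 0
  isDual : IsDual A lam x (dualVec A b x)

theorem IsRegular.mulVec_ne {A : Matrix (Fin m) (Fin n) ℝ}
    {f : EuclideanSpace ℝ (Fin m) →L[ℝ] ℝ} {ρ R l Λ lam : ℝ} {b : EuclideanSpace ℝ (Fin m)}
    {x : EuclideanSpace ℝ (Fin n)} (h : IsRegular A f ρ R l Λ b lam x) (hρ : 0 < ρ) :
    mulVec A x ≠ b :=
  sub_ne_zero.1 (norm_pos_iff.1 (hρ.trans_le h.le_residual))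

theorem IsRegular.residual_mul_map_dualVec {A : Matrix (Fin m) (Fin n) ℝ}
    {f : EuclideanSpace ℝ (Fin m) →L[ℝ] ℝ} {ρ R l Λ lam : ℝ} {b : EuclideanSpace ℝ (Fin m)}
    {x : EuclideanSpace ℝ (Fin n)} (h : IsRegular A f ρ R l Λ b lam x) (hρ : 0 < ρ) :
    ‖mulVec A x - b‖ * f (dualVec A b x) = f b := by
  have := congrArg f (norm_smul_dualVec (h.mulVec_ne hρ))
  rwa [map_smul, smul_eq_mul, map_sub, h.map_eq_zero, sub_zero] at this

/-- The residual norm of regular solutions is controlled by the data and the dual vectors. -/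
theorem IsRegular.abs_residual_sub_le {A : Matrix (Fin m) (Fin n) ℝ}
    {f : EuclideanSpace ℝ (Fin m) →L[ℝ] ℝ} {ρ R l Λ : ℝ} (hρ : 0 < ρ) (hR : 0 < R)
    {b b' : EuclideanSpace ℝ (Fin m)} {lam lam' : ℝ} {x x' : EuclideanSpace ℝ (Fin n)} {d : ℝ}
    (hx : IsRegular A f ρ R l Λ b lam x) (hx' : IsRegular A f ρ R l Λ b' lam' x')
    (hbd : ‖b - b'‖ ≤ d) :
    |‖mulVec A x - b‖ - ‖mulVec A x' - b'‖|
      ≤ 2 * R * ‖f‖ * d + 2 * R * (R * ‖f‖) * ‖dualVec A b x - dualVec A b' x'‖ := by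
  have hfy := hx.residual_mul_map_dualVec hρ
  have hfy' := hx'.residual_mul_map_dualVec hρ
  have hr0 := hρ.trans_le hx.le_residual
  have hr0' := hρ.trans_le hx'.le_residual
  have hrR := hx.residual_le
  have hrR' := hx'.residual_le
  have hfb := hx.half_le
  generalize ‖mulVec A x - b‖ = r at *
  generalize ‖mulVec A x' - b'‖ = r' at *
  generalize dualVec A b x = y at *
  generalize dualVec A b' x' = y' at *
  have hf : ∀ v, |f v| ≤ ‖f‖ * ‖v‖ := fun v => f.le_opNorm v
  have h1 : (r - r') * f y = f (b - b') - r' * f (y - y') := by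
    rw [map_sub, map_sub, ← hfy, ← hfy']
    ring
  -- This lower bound on `|f y|` allows division by it in `h1`.
  have h2 : 1 / 2 ≤ R * |f y| := by
    calc 1 / 2 ≤ r * f y := by rw [hfy]; exact hfb
      _ ≤ r * |f y| := mul_le_mul_of_nonneg_left (le_abs_self _) hr0.le
      _ ≤ _ := mul_le_mul_of_nonneg_right hrR (abs_nonneg _)
  have h3 : |r - r'| * |f y| ≤ ‖f‖ * d + R * (‖f‖ * ‖y - y'‖) := by
    rw [← abs_mul, h1]
    calc |f (b - b') - r' * f (y - y')| ≤ |f (b - b')| + |r' * f (y - y')| := abs_sub _ _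
      _ ≤ _ := by
        rw [abs_mul, abs_of_pos hr0']
        exact add_le_add ((hf _).trans (mul_le_mul_of_nonneg_left hbd (norm_nonneg f)))
          (mul_le_mul hrR' (hf _) (abs_nonneg _) hR.le)
  have h4 := mul_le_mul_of_nonneg_left h2 (abs_nonneg (r - r'))
  have h5 := mul_le_mul_of_nonneg_left h3 hR.le
  linarith

/-- Supplies the strong monotonicity in `y`; the crossed weights `lam'`, `lam` are those for which
the `ℓ¹` terms cancel in `IsDual.inner_nonneg`. -/
theorem inner_smul_sub_smul_of_norm_eq_one {F : Type*} [NormedAddCommGroup F]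
    [InnerProductSpace ℝ F] {y y' : F} (hy : ‖y‖ = 1) (hy' : ‖y'‖ = 1) (lam lam' r r' : ℝ) :
    ⟪lam' • y - lam • y', r • y - r' • y'⟫_ℝ
      = (lam' * r' + lam * r) / 2 * ‖y - y'‖ ^ 2 - (lam - lam') * (r - r') := by
  rw [norm_sub_sq_real, hy, hy', inner_sub_left, inner_sub_right, inner_sub_right]
  simp only [real_inner_smul_left, real_inner_smul_right]
  rw [real_inner_self_eq_norm_sq, real_inner_self_eq_norm_sq, hy, hy', real_inner_comm y y']
  ring

/-- Monotonicity of the subdifferential of the `ℓ¹` norm, in terms of dual vectors. -/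
theorem IsDual.inner_nonneg {A : Matrix (Fin m) (Fin n) ℝ} {lam lam' : ℝ}
    {x x' : EuclideanSpace ℝ (Fin n)} {y y' : EuclideanSpace ℝ (Fin m)} (h : IsDual A lam x y)
    (h' : IsDual A lam' x' y') (hl : 0 ≤ lam) (hl' : 0 ≤ lam') :
    0 ≤ ⟪lam' • y - lam • y', mulVec A x - mulVec A x'⟫_ℝ := by
  rw [inner_sub_left, inner_sub_right, inner_sub_right]
  simp only [real_inner_smul_left]
  rw [h.eq, h'.eq]
  have h1 := mul_le_mul_of_nonneg_left (h.le x') hl'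
  have h2 := mul_le_mul_of_nonneg_left (h'.le x) hl
  linarith

/-- If the bound failed, then `d ≤ e`, so every term on the right of `h` is at most a multiple of `e
* d`, and one factor `e` can be divided out. The `+ 1` outside the quotient secures `d ≤ e`. -/
theorem le_mul_of_sq_le {c K₀ K₁ K₂ d e : ℝ} (hc : 0 < c) (h₀ : 0 ≤ K₀) (h₁ : 0 ≤ K₁)
    (h₂ : 0 ≤ K₂) (hd : 0 ≤ d) (h : c * e ^ 2 ≤ (K₀ * e + d) * d + d * (K₁ * d + K₂ * e)) :
    e ≤ ((K₀ + K₂ + 1 + K₁) / c + 1) * d := by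
  set k := (K₀ + K₂ + 1 + K₁) / c with hk
  have hk0 : 0 ≤ k := by positivity
  by_contra! hlt
  have he1 : 0 < e := lt_of_le_of_lt (by positivity) hlt
  have hde : d ≤ e := by nlinarith
  have h1 : c * (k * (e * d)) = (K₀ + K₂ + 1 + K₁) * (e * d) := by
    rw [hk]
    field_simp
  have h2 : k * (e * d) < e ^ 2 := by nlinarith
  have h3 := mul_lt_mul_of_pos_left h2 hc
  have h4 : d * d ≤ e * d := mul_le_mul_of_nonneg_right hde hd
  have h5 := mul_le_mul_of_nonneg_left h4 h₁
  linarith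

/-- Dual vectors of regular solutions depend on the data in a Lipschitz way. -/
theorem IsRegular.norm_dualVec_sub_le {A : Matrix (Fin m) (Fin n) ℝ}
    {f : EuclideanSpace ℝ (Fin m) →L[ℝ] ℝ} {ρ R l Λ : ℝ} (hρ : 0 < ρ) (hR : 0 < R) (hl : 0 < l)
    (hΛ : 0 < Λ) {b b' : EuclideanSpace ℝ (Fin m)} {lam lam' : ℝ}
    {x x' : EuclideanSpace ℝ (Fin n)} {d : ℝ}
    (hx : IsRegular A f ρ R l Λ b lam x) (hx' : IsRegular A f ρ R l Λ b' lam' x')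
    (hbd : ‖b - b'‖ ≤ d) (hld : |lam - lam'| ≤ d) :
    ‖dualVec A b x - dualVec A b' x'‖
      ≤ ((Λ + 2 * R * (R * ‖f‖) + 1 + 2 * R * ‖f‖) / (l * ρ) + 1) * d := by
  have hd0 : 0 ≤ d := (norm_nonneg _).trans hbd
  have hf0 := norm_nonneg f
  have hrr := hx.abs_residual_sub_le hρ hR hx' hbd
  have hl0 : 0 < lam := hl.trans_le hx.le_param
  have hl0' : 0 < lam' := hl.trans_le hx'.le_param
  have hmono := hx.isDual.inner_nonneg hx'.isDual hl0.le hl0'.le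
  have hy := norm_dualVec (hx.mulVec_ne hρ)
  have hy' := norm_dualVec (hx'.mulVec_ne hρ)
  have hAx : mulVec A x - mulVec A x' = (b - b') - (‖mulVec A x - b‖ • dualVec A b x
      - ‖mulVec A x' - b'‖ • dualVec A b' x') := by
    rw [norm_smul_dualVec (hx.mulVec_ne hρ), norm_smul_dualVec (hx'.mulVec_ne hρ)]
    abel
  rw [hAx] at hmono
  have h4 : l * ρ ≤ lam' * ‖mulVec A x' - b'‖ :=
    mul_le_mul hx'.le_param hx'.le_residual hρ.le hl0'.le
  have h5 : l * ρ ≤ lam * ‖mulVec A x - b‖ :=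
    mul_le_mul hx.le_param hx.le_residual hρ.le hl0.le
  have hlΛ := hx'.param_le
  generalize ‖mulVec A x - b‖ = r at *
  generalize ‖mulVec A x' - b'‖ = r' at *
  generalize dualVec A b x = y at *
  generalize dualVec A b' x' = y' at *
  have hnorm : ‖lam' • y - lam • y'‖ ≤ Λ * ‖y - y'‖ + d := by
    have h1 : lam' • y - lam • y' = lam' • (y - y') - (lam - lam') • y' := by module
    rw [h1]
    refine (norm_sub_le _ _).trans ?_
    rw [norm_smul, norm_smul, hy', mul_one, Real.norm_eq_abs, Real.norm_eq_abs, abs_of_pos hl0']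
    exact add_le_add (mul_le_mul_of_nonneg_right hlΛ (norm_nonneg _)) hld
  rw [inner_sub_right, inner_smul_sub_smul_of_norm_eq_one hy hy'] at hmono
  have h1 : ⟪lam' • y - lam • y', b - b'⟫_ℝ ≤ (Λ * ‖y - y'‖ + d) * d :=
    (real_inner_le_norm _ _).trans
      (mul_le_mul hnorm hbd (norm_nonneg _) ((norm_nonneg _).trans hnorm))
  have h2 : (lam - lam') * (r - r')
      ≤ d * (2 * R * ‖f‖ * d + 2 * R * (R * ‖f‖) * ‖y - y'‖) := by
    refine (le_abs_self _).trans ?_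
    rw [abs_mul]
    exact mul_le_mul hld hrr (abs_nonneg _) hd0
  have h6 : l * ρ * ‖y - y'‖ ^ 2 ≤ (lam' * r' + lam * r) / 2 * ‖y - y'‖ ^ 2 :=
    mul_le_mul_of_nonneg_right (by linarith) (sq_nonneg _)
  exact le_mul_of_sq_le (mul_pos hl hρ) hΛ.le (by positivity) (by positivity) hd0 (by linarith)

/-- Images and `ℓ¹` norms of regular solutions depend on the data in a Lipschitz way. -/
theorem IsRegular.exists_lipschitz (A : Matrix (Fin m) (Fin n) ℝ)
    (f : EuclideanSpace ℝ (Fin m) →L[ℝ] ℝ) {ρ R l Λ : ℝ} (hρ : 0 < ρ) (hR : 0 < R) (hl : 0 < l)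
    (hΛ : 0 < Λ) :
    ∃ C : ℝ, 0 ≤ C ∧ ∀ (b b' : EuclideanSpace ℝ (Fin m)) (lam lam' : ℝ)
      (x x' : EuclideanSpace ℝ (Fin n)) (d : ℝ), IsRegular A f ρ R l Λ b lam x →
      IsRegular A f ρ R l Λ b' lam' x' → ‖b - b'‖ ≤ d → |lam - lam'| ≤ d →
      ‖mulVec A x - mulVec A x'‖ ≤ C * d ∧ l1 x - l1 x' ≤ C * d := by
  have hf0 := norm_nonneg f
  set k := (Λ + 2 * R * (R * ‖f‖) + 1 + 2 * R * ‖f‖) / (l * ρ) + 1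
  have hk0 : 0 ≤ k := by positivity
  set C := 1 + 2 * R * ‖f‖ + (2 * R * (R * ‖f‖) + R) * k with hC
  have hC0 : 0 ≤ C := by positivity
  refine ⟨C + C / l, by positivity, fun b b' lam lam' x x' d hx hx' hbd hld => ?_⟩
  have hd0 : 0 ≤ d := (norm_nonneg _).trans hbd
  have hed := hx.norm_dualVec_sub_le hρ hR hl hΛ hx' hbd hld
  have hrr := hx.abs_residual_sub_le hρ hR hx' hbd
  have hy := norm_dualVec (hx.mulVec_ne hρ)
  have hA : ‖mulVec A x - mulVec A x'‖ ≤ C * d := by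
    have hAx : mulVec A x - mulVec A x' = (b - b') - (‖mulVec A x - b‖ • dualVec A b x
        - ‖mulVec A x' - b'‖ • dualVec A b' x') := by
      rw [norm_smul_dualVec (hx.mulVec_ne hρ), norm_smul_dualVec (hx'.mulVec_ne hρ)]
      abel
    have hr0' := hρ.trans_le hx'.le_residual
    have hrR' := hx'.residual_le
    rw [hAx]
    generalize ‖mulVec A x - b‖ = r at *
    generalize ‖mulVec A x' - b'‖ = r' at *
    generalize dualVec A b x = y at *
    generalize dualVec A b' x' = y' at *
    have h1 : r • y - r' • y' = (r - r') • y + r' • (y - y') := by module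
    have h2 : 2 * R * (R * ‖f‖) * ‖y - y'‖ ≤ 2 * R * (R * ‖f‖) * (k * d) :=
      mul_le_mul_of_nonneg_left hed (by positivity)
    have h3 : r' * ‖y - y'‖ ≤ R * (k * d) := mul_le_mul hrR' hed (norm_nonneg _) hR.le
    rw [h1]
    calc ‖b - b' - ((r - r') • y + r' • (y - y'))‖
        ≤ ‖b - b'‖ + (‖(r - r') • y‖ + ‖r' • (y - y')‖) :=
          (norm_sub_le _ _).trans (add_le_add_right (norm_add_le _ _) _)
      _ = ‖b - b'‖ + (|r - r'| + r' * ‖y - y'‖) := by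
          rw [norm_smul, norm_smul, hy, mul_one, Real.norm_eq_abs, Real.norm_eq_abs,
            abs_of_pos hr0']
      _ ≤ d + ((2 * R * ‖f‖ * d + 2 * R * (R * ‖f‖) * (k * d)) + R * (k * d)) := by linarith
      _ = C * d := by rw [hC]; ring
  have hl1 : l1 x - l1 x' ≤ C / l * d := by
    -- The subgradient inequality for the unit vector `y` reduces the `ℓ¹` estimate to the one for
    -- images.
    have h1 : lam * (l1 x - l1 x') ≤ C * d := by
      have h2 := real_inner_le_norm (dualVec A b x) (mulVec A x - mulVec A x')
      rw [inner_sub_right, hx.isDual.eq, hy, one_mul] at h2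
      linarith [hx.isDual.le x']
    rw [div_mul_eq_mul_div, le_div_iff₀ hl]
    rcases le_total 0 (l1 x - l1 x') with hs | hs
    · have := mul_le_mul_of_nonneg_right hx.le_param hs
      linarith
    · have h3 : 0 ≤ C * d := by positivity
      have h4 := mul_nonpos_of_nonpos_of_nonneg hs hl.le
      linarith
  have hCl : 0 ≤ C / l * d := by positivity
  have hCd : 0 ≤ C * d := by positivity
  rw [add_mul]
  exact ⟨by linarith, by linarith⟩

/-! ### Outer semicontinuity and sufficiency -/

theorem isClosed_graph_solutionMap (A : Matrix (Fin m) (Fin n) ℝ) :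
    IsClosed {q : WithLp 2 (EuclideanSpace ℝ (Fin m) × ℝ) × EuclideanSpace ℝ (Fin n) |
      q.2 ∈ solutionMap A q.1} := by
  have h1 := continuous_mulVec A
  have h2 := continuous_l1 (n := n)
  have h3 := WithLp.continuous_fst 2 (EuclideanSpace ℝ (Fin m)) ℝ
  have h4 := WithLp.continuous_snd 2 (EuclideanSpace ℝ (Fin m)) ℝ
  have h5 : {q : WithLp 2 (EuclideanSpace ℝ (Fin m) × ℝ) × EuclideanSpace ℝ (Fin n) |
      q.2 ∈ solutionMap A q.1} =
      ⋂ z, {q | ‖mulVec A q.2 - q.1.fst‖ + q.1.snd * l1 q.2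
        ≤ ‖mulVec A z - q.1.fst‖ + q.1.snd * l1 z} := by
    ext q
    simp only [Set.mem_iInter]
    rfl
  rw [h5]
  exact isClosed_iInter fun z => isClosed_le (by fun_prop) (by fun_prop)

/-- The solution mapping of the SR-LASSO is outer semicontinuous and locally bounded: any open
neighbourhood of the fiber of its graph over a point contains the fibers over nearby points. -/
theorem eventually_forall_mem_solutionMap {A : Matrix (Fin m) (Fin n) ℝ}
    {p₀ : WithLp 2 (EuclideanSpace ℝ (Fin m) × ℝ)} (hp₀ : 0 < p₀.snd)
    {U : Set (WithLp 2 (EuclideanSpace ℝ (Fin m) × ℝ) × EuclideanSpace ℝ (Fin n))}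
    (hU : IsOpen U) (h : ∀ x ∈ solutionMap A p₀, (p₀, x) ∈ U) :
    ∀ᶠ p in 𝓝 p₀, ∀ x ∈ solutionMap A p, (p, x) ∈ U := by
  have h3 := WithLp.continuous_fst 2 (EuclideanSpace ℝ (Fin m)) ℝ
  have h4 := WithLp.continuous_snd 2 (EuclideanSpace ℝ (Fin m)) ℝ
  have hK : IsCompact (Metric.closedBall (0 : EuclideanSpace ℝ (Fin n))
      ((‖p₀.fst‖ + 1) / (p₀.snd / 2))) := isCompact_closedBall _ _
  -- Tube lemma on a ball containing all nearby solutions: at solutions for `p₀` use `U`, elsewhere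
  -- use that the complement of the graph is open.
  have h1 := hK.eventually_forall_of_forall_eventually (x₀ := p₀)
    (P := fun p x => x ∈ solutionMap A p → (p, x) ∈ U) (fun x _ => by
      by_cases hx : x ∈ solutionMap A p₀
      · filter_upwards [hU.mem_nhds (h x hx)] with q hq _ using hq
      · filter_upwards [(isClosed_graph_solutionMap A).isOpen_compl.mem_nhds
          (show (p₀, x) ∈ _ from hx)] with q hq hq' using absurd hq' hq)
  have h2 : ∀ᶠ p in 𝓝 p₀, ‖p.fst‖ < ‖p₀.fst‖ + 1 :=
    (h3.norm.tendsto p₀).eventually_lt_const (lt_add_one _)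
  have h5 : ∀ᶠ p in 𝓝 p₀, p₀.snd / 2 < p.snd :=
    (h4.tendsto p₀).eventually_const_lt (half_lt_self hp₀)
  filter_upwards [h1, h2, h5] with p hp1 hp2 hp3 x hx
  refine hp1 x ?_ hx
  have hpos : 0 < p₀.snd / 2 := half_pos hp₀
  have h6 := mul_norm_le_of_mem_solutionSet (hpos.trans hp3).le hx
  rw [mem_closedBall_zero_iff, le_div_iff₀ hpos]
  have h7 := mul_le_mul_of_nonneg_right hp3.le (norm_nonneg x)
  linarith

/-- Near a point where the target is outside the range of the active columns, all solutions are
uniformly regular. -/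
theorem exists_eventually_isRegular {A : Matrix (Fin m) (Fin n) ℝ}
    {b : EuclideanSpace ℝ (Fin m)} {lam : ℝ} (hlam : 0 < lam) {x : EuclideanSpace ℝ (Fin n)}
    (hx : x ∈ solutionSet A b lam) (hne : mulVec A x ≠ b)
    (hb : b ∉ colRange A (activeSet A b lam x)) :
    ∃ f : EuclideanSpace ℝ (Fin m) →L[ℝ] ℝ,
      ∀ᶠ p in 𝓝 (WithLp.toLp 2 (b, lam)), ∀ z ∈ solutionMap A p,
        IsRegular A f (‖mulVec A x - b‖ / 2) (2 * ‖mulVec A x - b‖) (lam / 2) (2 * lam)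
          p.fst p.snd z := by
  have hr : 0 < ‖mulVec A x - b‖ := norm_pos_iff.2 (sub_ne_zero.2 hne)
  obtain ⟨g, hgb, hg⟩ := Submodule.exists_le_ker_of_notMem hb
  let f : EuclideanSpace ℝ (Fin m) →L[ℝ] ℝ := LinearMap.toContinuousLinearMap ((g b)⁻¹ • g)
  have hf : ∀ v, f v = (g b)⁻¹ * g v := fun v => rfl
  have hfb : f b = 1 := by rw [hf, inv_mul_cancel₀ hgb]
  have hf0 : ∀ v ∈ colRange A (activeSet A b lam x), f v = 0 := fun v hv => by
    rw [hf, LinearMap.mem_ker.1 (hg hv), mul_zero]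
  refine ⟨f, ?_⟩
  have c1 := continuous_mulVec A
  have c2 := continuous_corr A
  have c3 := WithLp.continuous_fst 2 (EuclideanSpace ℝ (Fin m)) ℝ
  have c4 := WithLp.continuous_snd 2 (EuclideanSpace ℝ (Fin m)) ℝ
  let U : Set (WithLp 2 (EuclideanSpace ℝ (Fin m) × ℝ) × EuclideanSpace ℝ (Fin n)) :=
    {q | ‖mulVec A x - b‖ / 2 < ‖mulVec A q.2 - q.1.fst‖} ∩
    {q | ‖mulVec A q.2 - q.1.fst‖ < 2 * ‖mulVec A x - b‖} ∩
    {q | lam / 2 < q.1.snd} ∩ {q | q.1.snd < 2 * lam} ∩ {q | 1 / 2 < f q.1.fst} ∩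
    -- Inactivity is stated after multiplication by the residual norm, which keeps both sides
    -- continuous even at zero residual.
    ⋂ i : Fin n, {q | i ∉ activeSet A b lam x →
      |corr A (q.1.fst - mulVec A q.2) i| ≠ q.1.snd * ‖mulVec A q.2 - q.1.fst‖}
  have hU : IsOpen U := by
    refine IsOpen.inter (IsOpen.inter (IsOpen.inter (IsOpen.inter (IsOpen.inter ?_ ?_) ?_) ?_) ?_)
      (isOpen_iInter_of_finite fun i => ?_)
    · exact isOpen_lt (by fun_prop) (by fun_prop)
    · exact isOpen_lt (by fun_prop) (by fun_prop)
    · exact isOpen_lt (by fun_prop) (by fun_prop)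
    · exact isOpen_lt (by fun_prop) (by fun_prop)
    · exact isOpen_lt (by fun_prop) (by fun_prop)
    · by_cases hi : i ∈ activeSet A b lam x
      · simp [hi]
      · simp only [hi, not_false_eq_true, forall_const]
        refine isOpen_ne_fun ?_ (by fun_prop)
        exact ((c2 i).comp (f := fun q : WithLp 2 (EuclideanSpace ℝ (Fin m) × ℝ) ×
          EuclideanSpace ℝ (Fin n) => q.1.fst - mulVec A q.2) (by fun_prop)).abs
  have hcorr : ∀ (b : EuclideanSpace ℝ (Fin m)) (z : EuclideanSpace ℝ (Fin n)) (i : Fin n),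
      mulVec A z ≠ b →
      |corr A (b - mulVec A z) i| = |corr A (dualVec A b z) i| * ‖mulVec A z - b‖ := by
    intro b z i hz
    rw [← norm_smul_dualVec hz, corr_smul, abs_mul, abs_norm, mul_comm]
  have hmem := eventually_forall_mem_solutionMap (A := A) (p₀ := WithLp.toLp 2 (b, lam)) hlam hU
    (fun z hz => by
      have hz' : mulVec A z = mulVec A x := mulVec_eq_of_notMem_colRange hlam.le hx hz hne hb
      refine ⟨⟨⟨⟨⟨?_, ?_⟩, ?_⟩, ?_⟩, ?_⟩, Set.mem_iInter.2 fun i hi => ?_⟩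
      · simpa [hz'] using half_lt_self hr
      · simpa [hz'] using by linarith
      · simpa using half_lt_self hlam
      · simpa using by linarith
      · change 1 / 2 < f b
        rw [hfb]
        norm_num
      · change |corr A (b - mulVec A z) i| ≠ lam * ‖mulVec A z - b‖
        rw [hz', hcorr b x i hne]
        exact fun h => hi (mem_activeSet.2 (mul_right_cancel₀ hr.ne' h)))
  filter_upwards [hmem] with p hp z hz
  obtain ⟨⟨⟨⟨⟨h1, h2⟩, h3⟩, h4⟩, h5⟩, h6⟩ := hp z hz
  simp only [Set.mem_ofPred_eq] at h1 h2 h3 h4 h5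
  have hzne : mulVec A z ≠ p.fst :=
    sub_ne_zero.1 (norm_pos_iff.1 ((half_pos hr).trans h1))
  have hdual := isDual_dualVec ((half_pos hlam).trans h3).le hz hzne
  refine ⟨h1.le, h2.le, h3.le, h4.le, h5.le, hf0 _ (mem_colRange_iff.2 ⟨z, fun i hi => ?_, rfl⟩),
    hdual⟩
  by_contra hzi
  refine Set.mem_iInter.1 h6 i hi ?_
  simp only
  rw [hcorr _ z i hzne, hdual.abs_corr_eq hzi]

/-- Given a solution `x` for `p` and any solution `x'` for `p'`, Hoffman's bound finds near `x` a
point with the image of `x'` and no larger `ℓ¹` norm; it is again a solution for `p'`. -/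
theorem locallyHausdorffLipschitzAt_of_notMem_colRange {A : Matrix (Fin m) (Fin n) ℝ}
    {b : EuclideanSpace ℝ (Fin m)} {lam : ℝ} (hlam : 0 < lam) {x : EuclideanSpace ℝ (Fin n)}
    (hx : x ∈ solutionSet A b lam) (hne : mulVec A x ≠ b)
    (hb : b ∉ colRange A (activeSet A b lam x)) :
    LocallyHausdorffLipschitzAt (solutionMap A) (WithLp.toLp 2 (b, lam)) := by
  have hr : 0 < ‖mulVec A x - b‖ := norm_pos_iff.2 (sub_ne_zero.2 hne)
  obtain ⟨f, hf⟩ := exists_eventually_isRegular hlam hx hne hb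
  obtain ⟨C, hC, hlip⟩ := IsRegular.exists_lipschitz A f (half_pos hr)
    (mul_pos two_pos hr) (half_pos hlam) (mul_pos two_pos hlam)
  obtain ⟨H, hH, hoff⟩ := exists_l1_hoffman_bound A
  obtain ⟨δ, hδ, hball⟩ := Metric.eventually_nhds_iff_ball.1 hf
  have key : ∀ p ∈ Metric.ball (WithLp.toLp 2 (b, lam)) δ,
      ∀ p' ∈ Metric.ball (WithLp.toLp 2 (b, lam)) δ, (solutionMap A p').Nonempty →
      ∀ x ∈ solutionMap A p, ∃ z ∈ solutionMap A p',
        edist x z ≤ ENNReal.ofReal ((H * C + 1) * dist p p') := by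
    rintro p hp p' hp' ⟨x', hx'⟩ x hx
    have hd1 : ‖p.fst - p'.fst‖ ≤ dist p p' := by
      rw [dist_eq_norm]; exact WithLp.norm_fst_le _ (p - p')
    have hd2 : |p.snd - p'.snd| ≤ dist p p' := by
      rw [dist_eq_norm]; exact WithLp.norm_snd_le _ (p - p')
    obtain ⟨h1, h2⟩ := hlip _ _ _ _ x x' _ (hball p hp x hx) (hball p' hp' x' hx') hd1 hd2
    obtain ⟨z, hz1, hz2, hz3⟩ := hoff x x' (C * dist p p') h1 (by linarith)
    refine ⟨z, fun w => ?_, ?_⟩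
    · refine le_trans ?_ (hx' w)
      have hl' : 0 ≤ p'.snd := (half_pos hlam).le.trans (hball p' hp' x' hx').le_param
      rw [objective_eq, objective_eq, hz1]
      exact add_le_add_right (mul_le_mul_of_nonneg_left hz2 hl') _
    · rw [edist_dist, dist_eq_norm]
      refine ENNReal.ofReal_le_ofReal (hz3.trans ?_)
      rw [add_mul, one_mul, mul_assoc]
      exact le_add_of_nonneg_right dist_nonneg
  have hpos : ∀ᶠ p in 𝓝 (WithLp.toLp 2 (b, lam)), 0 < p.snd :=
    ((WithLp.continuous_snd 2 (EuclideanSpace ℝ (Fin m)) ℝ).tendsto _).eventually_const_lt hlam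
  -- The radius also keeps the parameter positive, so that no solution set is empty.
  obtain ⟨δ', hδ', hball'⟩ := Metric.eventually_nhds_iff_ball.1 hpos
  refine ⟨min δ δ', lt_min hδ hδ', H * C + 1, by positivity, fun p hp p' hp' => ?_⟩
  have hs := Metric.ball_subset_ball (x := WithLp.toLp 2 (b, lam)) (min_le_left δ δ')
  have hs' := Metric.ball_subset_ball (x := WithLp.toLp 2 (b, lam)) (min_le_right δ δ')
  refine Metric.hausdorffEDist_le_of_mem_edist
    (key p (hs hp) p' (hs hp') (solutionSet_nonempty A _ (hball' p' (hs' hp')))) ?_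
  rw [dist_comm]
  exact key p' (hs hp') p (hs hp) (solutionSet_nonempty A _ (hball' p (hs' hp)))

/-! ### Necessity: variation of the `ℓ¹` norm on a solution set -/

theorem dist_toLp_toLp {E : Type*} [SeminormedAddCommGroup E] (b : E) (s t : ℝ) :
    dist (WithLp.toLp 2 (b, s)) (WithLp.toLp 2 (b, t)) = |s - t| := by
  rw [WithLp.prod_dist_eq_of_L2]
  change √(dist b b ^ 2 + dist s t ^ 2) = _
  rw [dist_self, zero_pow two_ne_zero, zero_add, Real.sqrt_sq dist_nonneg, Real.dist_eq]

/-- Points of different `ℓ¹` norms in one solution set force the Hausdorff distance of the solution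
sets for smaller and larger parameters to stay away from zero. -/
theorem l1_le_add_of_hausdorffEDist_lt {A : Matrix (Fin m) (Fin n) ℝ}
    {b : EuclideanSpace ℝ (Fin m)} {lam lam₁ lam₂ : ℝ} (hlam₁ : lam₁ < lam) (hlam₂ : lam < lam₂)
    (hlam : 0 < lam) {x₁ x₂ : EuclideanSpace ℝ (Fin n)} {ε : ℝ} (hε : 0 < ε)
    (h : Metric.hausdorffEDist (solutionSet A b lam₂) (solutionSet A b lam₁) < ENNReal.ofReal ε)
    (h₁ : x₁ ∈ solutionSet A b lam) (h₂ : x₂ ∈ solutionSet A b lam) :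
    l1 x₂ ≤ l1 x₁ + n * ε := by
  obtain ⟨z, hz⟩ := solutionSet_nonempty A b (hlam.trans hlam₂)
  obtain ⟨z', hz', hzz'⟩ := Metric.exists_edist_lt_of_hausdorffEDist_lt hz h
  rw [edist_dist, ENNReal.ofReal_lt_ofReal_iff hε, dist_comm, dist_eq_norm] at hzz'
  have e1 := l1_antitone_of_mem_solutionSet hlam₂ h₁ hz
  have e2 := l1_antitone_of_mem_solutionSet hlam₁ hz' h₂
  have e3 := l1_sub_le z' z
  have e4 := mul_le_mul_of_nonneg_left hzz'.le (Nat.cast_nonneg (α := ℝ) n)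
  linarith

theorem continuous_toLp_prodMk_right {E : Type*} [SeminormedAddCommGroup E] (b : E) :
    Continuous fun s : ℝ => WithLp.toLp 2 (b, s) :=
  (WithLp.prod_continuous_toLp 2 E ℝ).comp (by fun_prop)

/-- If the solution mapping is Hausdorff Lipschitz on a ball, then the `ℓ¹` norm is constant on
each of its values over the ball. -/
theorem l1_le_of_hausdorffLipschitz {A : Matrix (Fin m) (Fin n) ℝ}
    {p₀ : WithLp 2 (EuclideanSpace ℝ (Fin m) × ℝ)} {δ L : ℝ} (hL : 0 < L)
    (h : ∀ p ∈ Metric.ball p₀ δ, ∀ p' ∈ Metric.ball p₀ δ,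
      Metric.hausdorffEDist (solutionMap A p) (solutionMap A p') ≤ ENNReal.ofReal (L * dist p p'))
    {b : EuclideanSpace ℝ (Fin m)} {lam : ℝ} (hlam : 0 < lam)
    (hp : WithLp.toLp 2 (b, lam) ∈ Metric.ball p₀ δ) {x₁ x₂ : EuclideanSpace ℝ (Fin n)}
    (h₁ : x₁ ∈ solutionSet A b lam) (h₂ : x₂ ∈ solutionSet A b lam) : l1 x₂ ≤ l1 x₁ := by
  obtain ⟨η, hη, hball⟩ := Metric.eventually_nhds_iff.1
    ((continuous_toLp_prodMk_right b).continuousAt.eventually (Metric.isOpen_ball.mem_nhds hp))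
  -- The parameters `lam ± t` are `2 * t` apart; the extra `t` makes the Hausdorff bound strict.
  have hlim : Tendsto (fun t : ℝ => l1 x₁ + n * (L * (2 * t) + t)) (𝓝[>] 0) (𝓝 (l1 x₁)) := by
    have hcont : Continuous fun t : ℝ => l1 x₁ + n * (L * (2 * t) + t) := by fun_prop
    simpa using (hcont.tendsto 0).mono_left (nhdsWithin_le_nhds (s := Set.Ioi 0))
  refine ge_of_tendsto hlim ?_
  filter_upwards [Ioo_mem_nhdsGT hη] with t ht
  have ht0 : 0 < t := ht.1
  have hH := h _ (@hball (lam + t) (by simpa [abs_of_pos ht0] using ht.2))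
    _ (@hball (lam - t) (by simpa [Real.dist_eq, abs_of_pos ht0] using ht.2))
  rw [dist_toLp_toLp, show lam + t - (lam - t) = 2 * t by ring,
    abs_of_pos (by positivity)] at hH
  exact l1_le_add_of_hausdorffEDist_lt (sub_lt_self _ ht0) (lt_add_of_pos_right _ ht0) hlam
    (by positivity) (lt_of_le_of_lt hH
      ((ENNReal.ofReal_lt_ofReal_iff (by positivity)).2 (lt_add_of_pos_right _ ht0))) h₁ h₂

/-- If the target is in the range of the active columns, then arbitrarily close to it there is a
target whose solution set contains points of different `ℓ¹` norms. -/
theorem exists_l1_lt_of_mem_colRange {A : Matrix (Fin m) (Fin n) ℝ}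
    {b : EuclideanSpace ℝ (Fin m)} {lam : ℝ} (hlam : 0 < lam) {x : EuclideanSpace ℝ (Fin n)}
    (hx : x ∈ solutionSet A b lam) (hne : mulVec A x ≠ b)
    (hb : b ∈ colRange A (activeSet A b lam x))
    {U : Set (EuclideanSpace ℝ (Fin m))} (hU : U ∈ 𝓝 b) :
    ∃ b' ∈ U, ∃ x₁ ∈ solutionSet A b' lam, ∃ x₂ ∈ solutionSet A b' lam, l1 x₁ < l1 x₂ := by
  have hr : 0 < ‖mulVec A x - b‖ := norm_pos_iff.2 (sub_ne_zero.2 hne)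
  have hd := isDual_dualVec hlam.le hx hne
  have hy := norm_dualVec hne
  have hry := norm_smul_dualVec hne
  obtain ⟨v, hv, rfl⟩ := mem_colRange_iff.1 hb
  simp only [mem_activeSet] at hv
  generalize ‖mulVec A x - mulVec A v‖ = r at *
  generalize dualVec A (mulVec A v) x = y at *
  obtain ⟨hbd, he⟩ := isDual_iff.1 hd
  -- Moving along `s` pushes every active coordinate strictly into its correct sign; shifting `v`
  -- and `x` together leaves the residual unchanged.
  let s : EuclideanSpace ℝ (Fin n) :=
    WithLp.toLp 2 fun i => if |corr A y i| = lam then corr A y i else 0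
  have hs : ∀ i, |corr A y i| = lam → s i = corr A y i := fun i hi => by simp [s, hi]
  have hs0 : ∀ i, |corr A y i| ≠ lam → s i = 0 := fun i hi => by simp [s, hi]
  have hx0 : ∀ i, |corr A y i| ≠ lam → x i = 0 := fun i hi =>
    by_contra fun h => hi (hd.abs_corr_eq h)
  obtain ⟨ε, hεU, hε⟩ : ∃ ε : ℝ, mulVec A (v + ε • s) ∈ U ∧ 0 < ε := by
    have h1 := continuous_mulVec A
    have hcont : Continuous fun ε : ℝ => mulVec A (v + ε • s) := by fun_prop
    have := (hcont.tendsto 0).mono_left (nhdsWithin_le_nhds (s := Set.Ioi 0))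
    simp only [zero_smul, add_zero] at this
    exact ((this.eventually hU).and self_mem_nhdsWithin).exists
  set x₁ := x + ε • s with hx₁
  have hx₁0 : ∀ i, |corr A y i| ≠ lam → x₁ i = 0 := fun i hi => by simp [hx₁, hx0 i hi, hs0 i hi]
  have hx₁pos : ∀ i, |corr A y i| = lam → 0 < x₁ i * corr A y i := fun i hi => by
    have h1 : x₁ i * corr A y i = lam * |x i| + ε * (corr A y i * corr A y i) := by
      rw [← he i, hx₁]
      simp only [PiLp.add_apply, PiLp.smul_apply, smul_eq_mul, hs i hi]
      ring
    have h2 : corr A y i ≠ 0 := abs_pos.1 (hi ▸ hlam)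
    have h3 : 0 < corr A y i * corr A y i := mul_self_pos.2 h2
    rw [h1]
    positivity
  have hd₁ : IsDual A lam x₁ y := isDual_of_forall hbd fun i hi =>
    have hi' : |corr A y i| = lam := by_contra fun h => hi (hx₁0 i h)
    ⟨hi', (hx₁pos i hi').le⟩
  have hres₁ : mulVec A (v + ε • s) - mulVec A x₁ = r • y := by
    rw [hry, hx₁]
    simp only [mulVec, map_add, map_smul]
    abel
  -- A short step towards the exact preimage `v + ε • s` keeps the strict signs and only shrinks the
  -- residual, by the factor `1 - τ`.
  obtain ⟨τ, hτpos, hτ⟩ : ∃ τ : ℝ, (∀ i, |corr A y i| = lam →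
      0 < (x₁ + τ • (v + ε • s - x₁)) i * corr A y i) ∧ τ ∈ Set.Ioo (0 : ℝ) 1 := by
    have : ∀ i, ∀ᶠ τ in 𝓝[>] (0 : ℝ), |corr A y i| = lam →
        0 < (x₁ + τ • (v + ε • s - x₁)) i * corr A y i := fun i => by
      by_cases hi : |corr A y i| = lam
      · have hcont : Continuous fun τ : ℝ => (x₁ + τ • (v + ε • s - x₁)) i * corr A y i := by
          fun_prop
        have h1 := (hcont.tendsto 0).eventually_const_lt (u := 0) (by simpa using hx₁pos i hi)
        filter_upwards [nhdsWithin_le_nhds h1] with τ hτ _ using hτ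
      · simp [hi]
    exact ((eventually_all.2 this).and (Ioo_mem_nhdsGT zero_lt_one)).exists
  set x₂ := x₁ + τ • (v + ε • s - x₁) with hx₂
  have hd₂ : IsDual A lam x₂ y := isDual_of_forall hbd fun i hi => by
    have hi' : |corr A y i| = lam := by_contra fun h => hi (by
      simp [hx₂, hx₁0 i h, hs0 i h, hv i h])
    exact ⟨hi', (hτpos i hi').le⟩
  have himg : mulVec A x₂ = mulVec A x₁ + τ • (r • y) := by
    rw [← hres₁, hx₂]
    simp only [mulVec, map_add, map_smul, map_sub]
  have hres₂ : mulVec A (v + ε • s) - mulVec A x₂ = ((1 - τ) * r) • y := by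
    rw [himg, ← sub_sub, hres₁]
    module
  refine ⟨_, hεU, x₁, mem_solutionSet_of_isDual hd₁ hy hr.le hres₁, x₂,
    mem_solutionSet_of_isDual hd₂ hy (mul_nonneg (sub_nonneg.2 hτ.2.le) hr.le) hres₂, ?_⟩
  -- Pairing the images with `y` gives `lam * (l1 x₂ - l1 x₁) = τ * r > 0`.
  have h1 := hd₂.eq
  rw [himg, inner_add_right, hd₁.eq, real_inner_smul_right, real_inner_smul_right,
    real_inner_self_eq_norm_sq, hy] at h1
  have h2 : 0 < τ * r := mul_pos hτ.1 hr
  refine lt_of_mul_lt_mul_left ?_ hlam.le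
  linarith

end SRLasso

theorem theorem5p2 {m n : ℕ} (A : Matrix (Fin m) (Fin n) ℝ)
    (b : EuclideanSpace ℝ (Fin m)) (lam : ℝ) (hlam : 0 < lam)
    (hne : {y | ∃ x ∈ SRLasso.solutionSet A b lam, SRLasso.mulVec A x = y} ≠ {b}) :
    SRLasso.LocallyHausdorffLipschitzAt (SRLasso.solutionMap A) (WithLp.toLp 2 (b, lam)) ↔
      ∃ x ∈ SRLasso.solutionSet A b lam, SRLasso.mulVec A x ≠ b ∧
        b ∉ SRLasso.colRange A (SRLasso.activeSet A b lam x) := by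
  constructor
  · rintro ⟨δ, hδ, L, hL, h⟩
    obtain ⟨x, hx, hxb⟩ : ∃ x ∈ SRLasso.solutionSet A b lam, SRLasso.mulVec A x ≠ b := by
      by_contra! hall
      refine hne (Set.eq_singleton_iff_unique_mem.2 ⟨?_, ?_⟩)
      · obtain ⟨x, hx⟩ := SRLasso.solutionSet_nonempty A b hlam
        exact ⟨x, hx, hall x hx⟩
      · rintro _ ⟨x, hx, rfl⟩
        exact hall x hx
    refine ⟨x, hx, hxb, fun hb => ?_⟩
    have hcont : Continuous fun b' : EuclideanSpace ℝ (Fin m) => WithLp.toLp 2 (b', lam) :=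
      (WithLp.prod_continuous_toLp 2 _ _).comp (by fun_prop)
    obtain ⟨b', hb', x₁, h₁, x₂, h₂, hlt⟩ := SRLasso.exists_l1_lt_of_mem_colRange hlam hx hxb hb
      (hcont.continuousAt.preimage_mem_nhds (Metric.ball_mem_nhds _ hδ))
    exact hlt.not_ge (SRLasso.l1_le_of_hausdorffLipschitz hL h hlam hb' h₁ h₂)
  · rintro ⟨x, hx, hxb, hb⟩
    exact SRLasso.locallyHausdorffLipschitzAt_of_notMem_colRange hlam hx hxb hb
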